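/- For a finite group $G$ let $$d(G)=\frac{|\{(x,y)\in G\times G : xy=yx\}|}{|G|^2}$$ be its commuting probability. A group $G$ is supersolvable if there is a finite series $1=N_0\le N_1\le\dots\le N_n=G$ of normal subgroups of $G$ such that every quotient $N_{i+1}/N_i$ is cyclic. Write $Z(G)$ for the center and $G'$ for the derived subgroup of $G$. Two groups $G$ and $H$ are isoclinic if there are isomorphisms $\varphi:G/Z(G)\to H/Z(H)$ and $\psi:G'\to H'$ such that, for all $g_1,g_2\in G$ and $h_1,h_2\in H$, if $\varphi(g_1Z(G))=h_1Z(H)$ and $\varphi(g_2Z(G))=h_2Z(H)$, then $\psi([g_1,g_2])=[h_1,h_2]$. Let $A_4$ be the alternating group of degree $4$. If $G$ is a finite group with $d(G)\ge 1/3$, then $G$ is either supersolvable or isoclinic to $A_4$. In other words, the groups isoclinic to $A_4$ are the only non-supersolvable groups with commuting probability at least $1/3$: a finite group $G$ is isoclinic to $A_4$ if and only if $d(G)\ge 1/3$ and $G$ is not supersolvable. -/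

import Mathlib

/-- A group `G` is supersolvable if it has a finite series
`1 = N 0 ≤ N 1 ≤ ⋯ ≤ N n = G` of subgroups that are all normal in the whole group `G`
and whose successive quotients `N (i + 1) / N i` are cyclic. -/
def IsSupersolvable (G : Type*) [Group G] : Prop :=
  ∃ (n : ℕ) (N : ℕ → Subgroup G) (_ : ∀ i, (N i).Normal),
    N 0 = ⊥ ∧ N n = ⊤ ∧
      ∀ i < n, N i ≤ N (i + 1) ∧ IsCyclic (N (i + 1) ⧸ (N i).subgroupOf (N (i + 1)))

open scoped commutatorElement in
/-- The commutator `⁅g₁, g₂⁆`, as an element of the derived subgroup of `G`. -/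
def derivedCommutator {G : Type*} [Group G] (g₁ g₂ : G) : commutator G :=
  ⟨⁅g₁, g₂⁆, Subgroup.commutator_mem_commutator (Subgroup.mem_top g₁) (Subgroup.mem_top g₂)⟩

/-- Two groups `G` and `H` are isoclinic if there are isomorphisms `φ : G / Z(G) ≃ H / Z(H)` and
`ψ : G' ≃ H'` that are compatible with the commutator maps: if `φ (g₁ Z(G)) = h₁ Z(H)` and
`φ (g₂ Z(G)) = h₂ Z(H)`, then `ψ ⁅g₁, g₂⁆ = ⁅h₁, h₂⁆`. -/
def IsIsoclinic (G H : Type*) [Group G] [Group H] : Prop :=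
  ∃ (φ : G ⧸ Subgroup.center G ≃* H ⧸ Subgroup.center H) (ψ : commutator G ≃* commutator H),
    ∀ (g₁ g₂ : G) (h₁ h₂ : H),
      φ (g₁ : G ⧸ Subgroup.center G) = (h₁ : H ⧸ Subgroup.center H) →
      φ (g₂ : G ⧸ Subgroup.center G) = (h₂ : H ⧸ Subgroup.center H) →
      ψ (derivedCommutator g₁ g₂) = derivedCommutator h₁ h₂

/-!
The groups isoclinic to `A₄` are handled through a structural description: `G` has an abelian
normal subgroup of index `3`, and its center has index `12` (`HasAlternatingFourType`).

Such a group is isoclinic to `A₄` (`HasAlternatingFourType.isIsoclinic`). The centralizer `H` of an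
element outside the abelian subgroup `W` of index `3` is abelian of index `4`. The transfers to `W`
and to `H` show that an element of `Z(G) ∩ G'` has cube and fourth power equal to `1`, so
`Z(G) ∩ G' = 1`. Hence the action on the cosets of `H` has kernel `Z(G)` and image `A₄`, and a
surjection whose kernel meets `G'` trivially is an isoclinism. Conversely, the commuting
probability is invariant under isoclinism and equals `1 / 3` for `A₄`, while a group isoclinic to
`A₄` has `A₄` as a quotient and so is not supersolvable.

It remains to show, by induction on the order, that a group `G` which is not supersolvable and has
`d(G) ≥ 1 / 3` has this structure (`hasAlternatingFourType_of_not_isSupersolvable`). Let `N` be a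
minimal normal subgroup.

* If `N` is cyclic, then `G / N` is not supersolvable and `d(G / N) ≥ d(G)`, so `G / N` has the
  structure by induction and `d(G / N) = 1 / 3`. Equality of `d(G)` and `d(G / N)` means that
  elements commuting modulo `N` commute, and so the structure lifts to `G`.
* If `N` is not abelian, then it is perfect and has no proper subgroup of index at most `4`, since
  the symmetric group of degree `4` is solvable. Elements outside `C_G(N)` therefore have at least
  five conjugates, which forces `d(G) < 1 / 3`.
* If `N` is abelian but not cyclic, let `C = C_G(N)` and `m = |G : C|`. If `|C ∩ C_G(x)| ≤ ε |C|`
  for all `x` outside `C`, then counting commuting pairs coset by coset gives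
  `d(G) ≤ ε (d(G / C) - 1 / m²) + d(C) / m²` (`commProb_le_of_card_inf_centralizer_le`).
  When `G / C` is not abelian, `ε = 1 / 2`, `d(G / C) ≤ 5 / 8` and `m ≥ 5` give `d(G) < 1 / 3`.
  When `G / C` is abelian, minimality of `N` makes every `x` outside `C` act on `N` without
  nontrivial fixed points, so `ε = 1 / |N| ≤ 1 / 4` is allowed, and `m ≥ 3` because elements acting
  by inversion only would make every subgroup of `N` normal in `G`. This bound is at most `1 / 3`,
  and equality forces `m = 3`, `C` abelian and `|C : Z(G)| = 4`.
-/

open scoped commutatorElement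

/-! ### Supersolvable groups -/

/-- For `H` normal, cyclicity of `K / (H ∩ K)` in terms of elements of the ambient group. -/
theorem isCyclic_quotient_subgroupOf_iff {G : Type*} [Group G] (H K : Subgroup G) [H.Normal] :
    IsCyclic (K ⧸ H.subgroupOf K) ↔ ∃ g ∈ K, ∀ k ∈ K, ∃ n : ℤ, (g ^ n)⁻¹ * k ∈ H := by
  constructor
  · rintro ⟨g, hg⟩
    induction g using QuotientGroup.induction_on with
    | H g =>
      refine ⟨g, g.2, fun k hk => ?_⟩
      obtain ⟨n, hn⟩ := hg ((⟨k, hk⟩ : K) : K ⧸ H.subgroupOf K)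
      refine ⟨n, ?_⟩
      have := QuotientGroup.eq.1 ((QuotientGroup.mk_zpow _ g n).trans hn)
      simpa [Subgroup.mem_subgroupOf] using this
  · rintro ⟨g, hg, h⟩
    refine ⟨⟨((⟨g, hg⟩ : K) : K ⧸ H.subgroupOf K), fun k => ?_⟩⟩
    induction k using QuotientGroup.induction_on with
    | H k =>
      obtain ⟨n, hn⟩ := h k k.2
      refine ⟨n, ?_⟩
      refine (QuotientGroup.mk_zpow _ _ n).symm.trans (QuotientGroup.eq.2 ?_)
      simpa [Subgroup.mem_subgroupOf] using hn

theorem IsSupersolvable.of_surjective {G H : Type*} [Group G] [Group H] (f : G →* H)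
    (hf : Function.Surjective f) (h : IsSupersolvable G) : IsSupersolvable H := by
  obtain ⟨n, N, hN, h0, h1, h2⟩ := h
  refine ⟨n, fun i => (N i).map f, fun i => (hN i).map f hf, by simp [h0], ?_, fun i hi => ?_⟩
  · simpa [h1, ← MonoidHom.range_eq_map] using MonoidHom.range_eq_top.2 hf
  · obtain ⟨h3, h4⟩ := h2 i hi
    have := hN i
    have := (hN i).map f hf
    refine ⟨Subgroup.map_mono h3, ?_⟩
    rw [isCyclic_quotient_subgroupOf_iff] at h4 ⊢
    obtain ⟨g, hg, h⟩ := h4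
    refine ⟨f g, Subgroup.mem_map_of_mem f hg, ?_⟩
    rintro _ ⟨k, hk, rfl⟩
    obtain ⟨m, hm⟩ := h k hk
    exact ⟨m, _, hm, by simp⟩

theorem isSupersolvable_of_subsingleton {G : Type*} [Group G] [Subsingleton G] :
    IsSupersolvable G :=
  ⟨0, fun _ => ⊥, fun _ => inferInstance, rfl, Subsingleton.elim _ _, by simp⟩

/-- An extension of a supersolvable group by a cyclic normal subgroup is supersolvable. -/
theorem IsSupersolvable.of_quotient {G : Type*} [Group G] (N : Subgroup G) [N.Normal]
    (hN : IsCyclic N) (h : IsSupersolvable (G ⧸ N)) : IsSupersolvable G := by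
  obtain ⟨n, S, hS, h0, h1, h2⟩ := h
  let T : ℕ → Subgroup G := fun i => Nat.casesOn i ⊥ fun j => (S j).comap (QuotientGroup.mk' N)
  have hT : ∀ i, (T i).Normal := by
    rintro (_ | j)
    · exact (inferInstance : (⊥ : Subgroup G).Normal)
    · exact (hS j).comap _
  refine ⟨n + 1, T, hT, rfl, by simp [T, h1], ?_⟩
  rintro (_ | i) hi
  · refine ⟨bot_le, (@isCyclic_quotient_subgroupOf_iff _ _ (T 0) (T 1) (hT 0)).2 ?_⟩
    obtain ⟨g, hg⟩ := hN
    refine ⟨g, by simp [T, h0], fun k hk => ?_⟩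
    have hk' : k ∈ N := by simpa [T, h0] using hk
    obtain ⟨m, hm⟩ := hg ⟨k, hk'⟩
    refine ⟨m, ?_⟩
    have : (g : G) ^ m = k := by simpa using congrArg Subtype.val hm
    simp [T, this]
  · obtain ⟨h3, h4⟩ := h2 i (by omega)
    have := hS i
    have := hT (i + 1)
    refine ⟨Subgroup.comap_mono h3, ?_⟩
    rw [isCyclic_quotient_subgroupOf_iff] at h4 ⊢
    obtain ⟨g, hg, h⟩ := h4
    obtain ⟨g, rfl⟩ := QuotientGroup.mk_surjective g
    refine ⟨g, hg, fun k hk => ?_⟩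
    obtain ⟨m, hm⟩ := h k hk
    exact ⟨m, by simpa [T] using hm⟩

/-! ### Counting commuting pairs -/

theorem commProb_eq_card_filter (G : Type*) [Group G] [Fintype G]
    [DecidablePred fun p : G × G => Commute p.1 p.2] :
    commProb G = ((Finset.univ.filter fun p : G × G => Commute p.1 p.2).card : ℚ) /
      (Nat.card G : ℚ) ^ 2 := by
  rw [commProb_def, Nat.card_eq_fintype_card, Fintype.card_subtype]

/-- If every element outside `D` has a centralizer of density at most `ε`, then `d(G)` is at most
the corresponding mean of `1` and `ε`. -/
theorem commProb_le_of_card_centralizer_le {G : Type*} [Group G] [Finite G]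
    (D : Subgroup G) (ε : ℚ)
    (h : ∀ x ∉ D,
      (Nat.card (Subgroup.centralizer {x} : Subgroup G) : ℚ) ≤ ε * Nat.card G) :
    commProb G ≤ ε + (1 - ε) / D.index := by
  classical
  have := Fintype.ofFinite G
  have hG : (0 : ℚ) < Nat.card G := by exact_mod_cast Nat.card_pos
  have hD : (Nat.card D : ℚ) * D.index = Nat.card G := by
    exact_mod_cast Subgroup.card_mul_index _
  have hi : (0 : ℚ) < D.index := by
    exact_mod_cast Nat.pos_of_ne_zero Subgroup.index_ne_zero_of_finite
  have hfib : ∀ x : G, ((Finset.univ.filter fun p : G × G => Commute p.1 p.2).filter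
      fun p => p.1 = x).card = Nat.card (Subgroup.centralizer {x} : Subgroup G) := by
    intro x
    rw [Nat.card_eq_fintype_card, Fintype.card_subtype]
    refine Finset.card_bij' (fun p _ => p.2) (fun y _ => (x, y)) ?_ ?_ ?_ ?_
    · rintro ⟨a, b⟩ hp
      simp only [Finset.mem_filter, Finset.mem_univ, true_and] at hp ⊢
      rw [Subgroup.mem_centralizer_singleton_iff, ← hp.2]
      exact hp.1.symm
    · intro y hy
      simp only [Finset.mem_filter, Finset.mem_univ, true_and] at hy ⊢
      rw [Subgroup.mem_centralizer_singleton_iff] at hy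
      exact ⟨hy.symm, trivial⟩
    · rintro ⟨a, b⟩ hp
      simp only [Finset.mem_filter, Finset.mem_univ, true_and] at hp
      simp [hp.2]
    · simp
  have hsum := Finset.card_eq_sum_card_fiberwise
    (s := Finset.univ.filter fun p : G × G => Commute p.1 p.2) (t := Finset.univ) (f := Prod.fst)
    (fun _ _ => Finset.mem_coe.2 (Finset.mem_univ _))
  simp only [hfib] at hsum
  have hb : ∀ x : G, (Nat.card (Subgroup.centralizer {x} : Subgroup G) : ℚ) ≤
      ε * Nat.card G + if x ∈ D then (1 - ε) * Nat.card G else 0 := by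
    intro x
    split_ifs with hx
    · have : (Nat.card (Subgroup.centralizer {x} : Subgroup G) : ℚ) ≤ Nat.card G := by
        exact_mod_cast Subgroup.card_le_card_group _
      linarith
    · simpa using h x hx
  rw [commProb_eq_card_filter, hsum, div_le_iff₀ (by positivity)]
  push_cast
  refine (Finset.sum_le_sum fun x _ => hb x).trans (le_of_eq ?_)
  have hc : ((Finset.univ.filter fun x => x ∈ D).card : ℚ) =
      Nat.card D := by
    rw [Nat.card_eq_fintype_card, Fintype.card_subtype]
  rw [Finset.sum_add_distrib, ← Finset.sum_filter, Finset.sum_const, Finset.sum_const, nsmul_eq_mul,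
    nsmul_eq_mul, hc, Finset.card_univ, ← Nat.card_eq_fintype_card, ← hD]
  field_simp

theorem Subgroup.two_mul_card_le_of_ne_top {G : Type*} [Group G] [Finite G] {H : Subgroup G}
    (h : H ≠ ⊤) : 2 * Nat.card H ≤ Nat.card G := by
  have h1 := Subgroup.card_mul_index H
  have h2 : 1 < H.index := Subgroup.one_lt_index_of_ne_top h
  nlinarith

theorem four_le_index_center {G : Type*} [Group G] [Finite G] {a b : G} (h : a * b ≠ b * a) :
    4 ≤ (Subgroup.center G).index := by
  by_contra hlt
  have hne := Subgroup.index_ne_zero_of_finite (H := Subgroup.center G)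
  have hc : IsCyclic (G ⧸ Subgroup.center G) := by
    have hcard : Nat.card (G ⧸ Subgroup.center G) = (Subgroup.center G).index := rfl
    have : (Subgroup.center G).index = 1 ∨ (Subgroup.center G).index = 2 ∨
      (Subgroup.center G).index = 3 := by omega
    rcases this with h1 | h1 | h1
    · have := (Nat.card_eq_one_iff_unique.1 (hcard.trans h1)).1
      infer_instance
    · have : Fact (Nat.Prime 2) := ⟨Nat.prime_two⟩
      exact isCyclic_of_prime_card (hcard.trans h1)
    · have : Fact (Nat.Prime 3) := ⟨Nat.prime_three⟩
      exact isCyclic_of_prime_card (hcard.trans h1)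
  have := MonoidHom.isMulCommutative_of_isCyclic_of_ker_le_center
    (QuotientGroup.mk' (Subgroup.center G)) (by simp)
  exact h (mul_comm' a b)

/-- The `5 / 8` bound for nonabelian groups. -/
theorem commProb_le_five_eighths {G : Type*} [Group G] [Finite G] {a b : G}
    (h : a * b ≠ b * a) : commProb G ≤ 5 / 8 := by
  refine (commProb_le_of_card_centralizer_le (Subgroup.center G) (1 / 2) fun x hx => ?_).trans ?_
  · have : (Subgroup.centralizer {x} : Subgroup G) ≠ ⊤ := by
      intro h
      refine hx ?_
      rw [Subgroup.centralizer_eq_top_iff_subset] at h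
      exact h rfl
    have : (2 * Nat.card (Subgroup.centralizer {x} : Subgroup G) : ℚ) ≤ Nat.card G := by
      exact_mod_cast Subgroup.two_mul_card_le_of_ne_top this
    linarith
  · have h4 : (4 : ℚ) ≤ (Subgroup.center G).index := by exact_mod_cast four_le_index_center h
    have : (1 - 1 / 2 : ℚ) / (Subgroup.center G).index ≤ (1 - 1 / 2) / 4 := by gcongr
    linarith

theorem five_le_card_of_not_commute {G : Type*} [Group G] [Finite G] {a b : G}
    (h : a * b ≠ b * a) : 5 ≤ Nat.card G := by
  classical
  have := Fintype.ofFinite G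
  have h5 : ({1, a, b, a * b, b * a} : Finset G).card = 5 := by
    have ha : a ≠ 1 := by rintro rfl; simp at h
    have hb : b ≠ 1 := by rintro rfl; simp at h
    have hab : a ≠ b := by rintro rfl; exact h rfl
    have h1 : a * b ≠ 1 := fun h1 => h (by rw [eq_inv_of_mul_eq_one_left h1]; simp)
    have h2 : b * a ≠ 1 := fun h1 => h (by rw [eq_inv_of_mul_eq_one_left h1]; simp)
    simp [Finset.card_insert_of_notMem, ha, hb, hab, h, h1.symm, h2.symm, ha.symm, hb.symm]
  rw [Nat.card_eq_fintype_card, ← h5]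
  exact Finset.card_le_univ _

/-- The number of commuting pairs of `G`, split according to the cosets of a normal subgroup `C`
that the two entries lie in. A pair of cosets contains no commuting pair unless it commutes in
`G ⧸ C`, and if one of them is not `C` itself then at most a proportion `ε` of its pairs
commute. -/
theorem commProb_le_of_card_inf_centralizer_le {G : Type*} [Group G] [Finite G]
    (C : Subgroup G) [C.Normal] (ε : ℚ) (hε : 0 ≤ ε)
    (h : ∀ x ∉ C, (Nat.card (C ⊓ Subgroup.centralizer {x} : Subgroup G) : ℚ) ≤ ε * Nat.card C) :
    commProb G ≤ ε * (commProb (G ⧸ C) - 1 / (C.index : ℚ) ^ 2) +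
      commProb C / (C.index : ℚ) ^ 2 := by
  classical
  have := Fintype.ofFinite G
  have := Fintype.ofFinite (G ⧸ C)
  have := Fintype.ofFinite C
  -- Rounding `ε |C|` down to an integer lets the counting take place in `ℕ`.
  set k : ℕ := ⌊ε * Nat.card C⌋₊ with hk
  have hkε : (k : ℚ) ≤ ε * Nat.card C := Nat.floor_le (by positivity)
  have hkx : ∀ x ∉ C, Nat.card (C ⊓ Subgroup.centralizer {x} : Subgroup G) ≤ k :=
    fun x hx => Nat.le_floor (h x hx)
  have hcoset : ∀ (b : G ⧸ C), (Finset.univ.filter fun y : G => (y : G ⧸ C) = b).card ≤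
      Nat.card C := by
    intro b
    obtain ⟨y₀, rfl⟩ := QuotientGroup.mk_surjective b
    rw [Nat.card_eq_fintype_card, Fintype.card_subtype]
    refine Finset.card_le_card_of_injOn (fun y => y₀⁻¹ * y) (fun y hy => ?_)
      (fun a _ b _ h => mul_left_cancel h)
    simpa using QuotientGroup.eq.1 (Finset.mem_filter.1 hy).2.symm
  have hcent : ∀ x ∉ C, ∀ (b : G ⧸ C),
      (Finset.univ.filter fun y : G => (y : G ⧸ C) = b ∧ Commute x y).card ≤ k := by
    intro x hx b
    refine le_trans ?_ (hkx x hx)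
    rcases Finset.eq_empty_or_nonempty
      (Finset.univ.filter fun y : G => (y : G ⧸ C) = b ∧ Commute x y) with h0 | ⟨y₀, hy₀⟩
    · simp [h0]
    simp only [Finset.mem_filter, Finset.mem_univ, true_and] at hy₀
    obtain ⟨rfl, hxy₀⟩ := hy₀
    rw [Nat.card_eq_fintype_card, Fintype.card_subtype]
    refine Finset.card_le_card_of_injOn (fun y => y₀⁻¹ * y) (fun y hy => ?_)
      (fun a _ b _ h => mul_left_cancel h)
    have hy := (Finset.mem_filter.1 hy).2
    simp only [Finset.coe_filter, Finset.mem_univ, true_and, Set.mem_ofPred_eq, Subgroup.mem_inf,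
      Subgroup.mem_centralizer_singleton_iff]
    exact ⟨QuotientGroup.eq.1 hy.1.symm, (hxy₀.inv_right.mul_right hy.2).symm⟩
  set S := Finset.univ.filter fun p : G × G => Commute p.1 p.2 with hS
  set T := Finset.univ.filter fun p : (G ⧸ C) × (G ⧸ C) => Commute p.1 p.2 with hT
  set π : G × G → (G ⧸ C) × (G ⧸ C) := fun p => (p.1, p.2) with hπ
  have hST : (S : Set (G × G)).MapsTo π T := by
    intro p hp
    have hp : Commute p.1 p.2 := (Finset.mem_filter.1 hp).2
    exact Finset.mem_coe.2 (Finset.mem_filter.2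
      ⟨Finset.mem_univ _, hp.map (QuotientGroup.mk' C)⟩)
  have h11 : (1, 1) ∈ T := by simp [hT]
  have hbound : ∀ q ∈ T.erase (1, 1), (S.filter fun p => π p = q).card ≤ k * Nat.card C := by
    rintro ⟨a, b⟩ hq
    have hab : a ≠ 1 ∨ b ≠ 1 := by
      by_contra! hcon
      exact (Finset.mem_erase.1 hq).1 (by rw [hcon.1, hcon.2])
    rcases hab with ha | hb
    · refine (Finset.card_le_mul_card_image (f := Prod.fst) _ k ?_).trans
        (Nat.mul_le_mul_left k ((Finset.card_le_card ?_).trans (hcoset a)))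
      · intro x hx
        simp only [Finset.mem_image, Finset.mem_filter, hπ, Prod.mk.injEq] at hx
        obtain ⟨p, ⟨-, hpa, -⟩, rfl⟩ := hx
        have hpC : p.1 ∉ C := fun hc => ha (hpa ▸ (QuotientGroup.eq_one_iff _).2 hc)
        refine le_trans ?_ (hcent p.1 hpC b)
        refine Finset.card_le_card_of_injOn Prod.snd (fun r hr => ?_) ?_
        · simp only [hS, hπ, Finset.coe_filter, Finset.mem_filter, Finset.mem_univ, true_and,
            Set.mem_ofPred_eq, Prod.mk.injEq] at hr ⊢
          exact ⟨hr.1.2.2, hr.2 ▸ hr.1.1⟩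
        · intro r hr s hs hrs
          exact Prod.ext ((Finset.mem_filter.1 hr).2.trans (Finset.mem_filter.1 hs).2.symm) hrs
      · intro x hx
        simp only [Finset.mem_image, Finset.mem_filter, hπ, Prod.mk.injEq] at hx ⊢
        obtain ⟨p, ⟨-, hpa, -⟩, rfl⟩ := hx
        exact ⟨Finset.mem_univ _, hpa⟩
    · refine (Finset.card_le_mul_card_image (f := Prod.snd) _ k ?_).trans
        (Nat.mul_le_mul_left k ((Finset.card_le_card ?_).trans (hcoset b)))
      · intro x hx
        simp only [Finset.mem_image, Finset.mem_filter, hπ, Prod.mk.injEq] at hx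
        obtain ⟨p, ⟨-, -, hpb⟩, rfl⟩ := hx
        have hpC : p.2 ∉ C := fun hc => hb (hpb ▸ (QuotientGroup.eq_one_iff _).2 hc)
        refine le_trans ?_ (hcent p.2 hpC a)
        refine Finset.card_le_card_of_injOn Prod.fst (fun r hr => ?_) ?_
        · simp only [hS, hπ, Finset.coe_filter, Finset.mem_filter, Finset.mem_univ, true_and,
            Set.mem_ofPred_eq, Prod.mk.injEq] at hr ⊢
          exact ⟨hr.1.2.1, hr.2 ▸ hr.1.1.symm⟩
        · intro r hr s hs hrs
          exact Prod.ext hrs ((Finset.mem_filter.1 hr).2.trans (Finset.mem_filter.1 hs).2.symm)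
      · intro x hx
        simp only [Finset.mem_image, Finset.mem_filter, hπ, Prod.mk.injEq] at hx ⊢
        obtain ⟨p, ⟨-, -, hpb⟩, rfl⟩ := hx
        exact ⟨Finset.mem_univ _, hpb⟩
  set SC := Finset.univ.filter fun p : C × C => Commute p.1 p.2 with hSC
  have hone : (S.filter fun p => π p = (1, 1)).card ≤ SC.card := by
    refine Finset.card_le_card_of_surjOn (fun p : C × C => ((p.1 : G), (p.2 : G))) ?_
    rintro ⟨x, y⟩ hp
    simp only [hS, hπ, Finset.coe_filter, Finset.mem_filter, Finset.mem_univ, true_and,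
      Set.mem_ofPred_eq, Prod.mk.injEq, QuotientGroup.eq_one_iff] at hp
    refine ⟨(⟨x, hp.2.1⟩, ⟨y, hp.2.2⟩), ?_, rfl⟩
    simp only [hSC, Finset.coe_filter, Finset.mem_univ, true_and, Set.mem_ofPred_eq]
    exact Subtype.ext hp.1
  have hsum : S.card ≤ (T.card - 1) * (k * Nat.card C) + SC.card := by
    rw [Finset.card_eq_sum_card_fiberwise hST, ← Finset.sum_erase_add _ _ h11,
      ← Finset.card_erase_of_mem h11]
    exact add_le_add (Finset.sum_le_card_nsmul _ _ _ hbound) hone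
  have hT1 : 1 ≤ T.card := Finset.card_pos.2 ⟨_, h11⟩
  have hsum' : (S.card : ℚ) ≤ (T.card - 1) * (ε * Nat.card C * Nat.card C) + SC.card := by
    have h1 : (S.card : ℚ) ≤ (T.card - 1) * (k * Nat.card C) + SC.card := by
      rw [← Nat.cast_one, ← Nat.cast_sub hT1]
      exact_mod_cast hsum
    have h2 : (0 : ℚ) ≤ T.card - 1 := by
      have : (1 : ℚ) ≤ T.card := by exact_mod_cast hT1
      linarith
    refine h1.trans ?_
    gcongr
  have hG : (Nat.card G : ℚ) = Nat.card C * C.index := by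
    exact_mod_cast (Subgroup.card_mul_index C).symm
  have hC0 : (0 : ℚ) < Nat.card C := by exact_mod_cast Nat.card_pos
  have hi0 : (0 : ℚ) < C.index := by
    exact_mod_cast Nat.pos_of_ne_zero Subgroup.index_ne_zero_of_finite
  have hQ : (Nat.card (G ⧸ C) : ℚ) = C.index := rfl
  rw [commProb_eq_card_filter G, commProb_eq_card_filter (G ⧸ C), commProb_eq_card_filter C, hG, hQ,
    ← hS, ← hT, ← hSC, div_le_iff₀ (by positivity)]
  refine hsum'.trans (le_of_eq ?_)
  field_simp

/-! ### The alternating group of degree four -/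

theorem commProb_alternatingGroup_four : commProb (alternatingGroup (Fin 4)) = 1 / 3 := by
  have h1 : Nat.card (alternatingGroup (Fin 4)) = 12 :=
    alternatingGroup.card_of_card_eq_four (by simp)
  have h2 : Nat.card { p : alternatingGroup (Fin 4) × alternatingGroup (Fin 4) //
      p.1 * p.2 = p.2 * p.1 } = 48 := by
    rw [Nat.card_eq_fintype_card]
    decide +kernel
  have h3 : Nat.card { p : alternatingGroup (Fin 4) × alternatingGroup (Fin 4) //
      Commute p.1 p.2 } = 48 := h2
  rw [commProb_def, h1, h3]
  norm_num

theorem center_alternatingGroup_four : Subgroup.center (alternatingGroup (Fin 4)) = ⊥ := by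
  have h : ∀ x : alternatingGroup (Fin 4), (∀ g, g * x = x * g) → x = 1 := by decide +kernel
  rw [eq_bot_iff]
  intro x hx
  exact h x (Subgroup.mem_center_iff.1 hx)

/-- In a supersolvable series the first nontrivial term is a cyclic normal subgroup, and `A₄` has
none. -/
theorem not_isSupersolvable_alternatingGroup_four :
    ¬ IsSupersolvable (alternatingGroup (Fin 4)) := by
  rintro ⟨n, N, hN, h0, h1, h2⟩
  -- Exponents may be reduced modulo `6`, the exponent of `A₄`.
  have h6 : ∀ x : alternatingGroup (Fin 4), x ^ 6 = 1 := by decide +kernel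
  have hconj : ∀ x : alternatingGroup (Fin 4), x ≠ 1 → ∃ g, ∀ k : Fin 6,
      g * x * g⁻¹ ≠ x ^ (k : ℕ) := by decide +kernel
  have hbot : ∀ i ≤ n, N i = ⊥ := by
    intro i
    induction i with
    | zero => exact fun _ => h0
    | succ i ih =>
      intro hi
      have hcyc := (h2 i (by omega)).2
      have := hN i
      rw [isCyclic_quotient_subgroupOf_iff, ih (by omega)] at hcyc
      obtain ⟨x, hx, hcyc⟩ := hcyc
      have hx1 : x = 1 := by
        by_contra hne
        obtain ⟨g, hg⟩ := hconj x hne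
        obtain ⟨m, hm⟩ := hcyc _ ((hN (i + 1)).conj_mem x hx g)
        rw [Subgroup.mem_bot, inv_mul_eq_one] at hm
        refine hg ⟨(m % 6).toNat, by omega⟩ ?_
        rw [← hm, ← zpow_natCast, Int.toNat_of_nonneg (by omega), ← Int.emod_add_mul_ediv m 6,
          zpow_add, zpow_mul, Int.emod_add_mul_ediv]
        simp [zpow_ofNat, h6 x]
      rw [eq_bot_iff]
      intro y hy
      obtain ⟨m, hm⟩ := hcyc y hy
      simpa [hx1] using hm
  have h12 : Nat.card (alternatingGroup (Fin 4)) = 12 :=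
    alternatingGroup.card_of_card_eq_four (by simp)
  have htop := h1.symm.trans (hbot n le_rfl)
  rw [← Subgroup.card_top, htop, Subgroup.card_bot] at h12
  omega

/-! ### Isoclinism -/

theorem derivedCommutator_eq_one_iff {G : Type*} [Group G] (x y : G) :
    derivedCommutator x y = 1 ↔ Commute x y := by
  rw [← commutatorElement_eq_one_iff_commute]
  exact ⟨fun h => congrArg Subtype.val h, fun h => Subtype.ext h⟩

theorem commutatorElement_mul_center {G : Type*} [Group G] {x y z w : G}
    (hz : z ∈ Subgroup.center G) (hw : w ∈ Subgroup.center G) :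
    ⁅x * z, y * w⁆ = ⁅x, y⁆ := by
  have h1 : ∀ g : G, ⁅z, g⁆ = 1 := fun g =>
    commutatorElement_eq_one_iff_mul_comm.2 (Subgroup.mem_center_iff.1 hz g).symm
  have h2 : ∀ g : G, ⁅g, w⁆ = 1 := fun g =>
    commutatorElement_eq_one_iff_mul_comm.2 (Subgroup.mem_center_iff.1 hw g)
  rw [commutatorElement_mul_left_eq_conj_mul, h1, commutatorElement_mul_right_eq_mul_conj, h2]
  simp

theorem commute_out_iff {G : Type*} [Group G] (x y : G) :
    Commute (x : G ⧸ Subgroup.center G).out (y : G ⧸ Subgroup.center G).out ↔ Commute x y := by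
  obtain ⟨z, hz⟩ := QuotientGroup.mk_out_eq_mul (Subgroup.center G) x
  obtain ⟨w, hw⟩ := QuotientGroup.mk_out_eq_mul (Subgroup.center G) y
  rw [hz, hw, ← commutatorElement_eq_one_iff_commute, commutatorElement_mul_center z.2 w.2,
    commutatorElement_eq_one_iff_commute]

/-- Pairs of elements with a property that depends only on their classes modulo `N`. -/
theorem card_pairs_eq_card_quotient_pairs {G : Type*} [Group G] (N : Subgroup G)
    (P : (G ⧸ N) × (G ⧸ N) → Prop) : Nat.card { p : G × G // P (p.1, p.2) } =
      Nat.card { q : (G ⧸ N) × (G ⧸ N) // P q } * (Nat.card N * Nat.card N) := by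
  let e : G ≃ (G ⧸ N) × N :=
    { toFun := fun x => ((x : G ⧸ N),
        ⟨(x : G ⧸ N).out⁻¹ * x, QuotientGroup.eq.1 (QuotientGroup.out_eq' _)⟩)
      invFun := fun q => q.1.out * q.2
      left_inv := fun x => by simp
      right_inv := fun q => by
        have h : ((q.1.out * q.2 : G) : G ⧸ N) = q.1 :=
          (QuotientGroup.mk_mul_of_mem _ q.2.2).trans (QuotientGroup.out_eq' _)
        exact Prod.ext h (Subtype.ext (by simp [h])) }
  let E := (e.prodCongr e).trans (Equiv.prodProdProdComm _ _ _ _)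
  have hE : ∀ p : G × G, P (p.1, p.2) ↔ P (E p).1 := fun p => Iff.rfl
  rw [← Nat.card_prod, ← Nat.card_prod]
  exact Nat.card_congr ((E.subtypeEquiv hE).trans
    (Equiv.prodSubtypeFstEquivSubtypeProd (p := P)))

/-- Whether a pair commutes depends only on its class modulo the center. -/
theorem commProb_eq_card_quotient_center (G : Type*) [Group G] [Finite G] : commProb G =
    Nat.card { q : (G ⧸ Subgroup.center G) × (G ⧸ Subgroup.center G) //
      Commute q.1.out q.2.out } / (Nat.card (G ⧸ Subgroup.center G) : ℚ) ^ 2 := by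
  have hc := card_pairs_eq_card_quotient_pairs (Subgroup.center G)
    fun q => Commute q.1.out q.2.out
  simp only [commute_out_iff] at hc
  have hG : Nat.card G = Nat.card (G ⧸ Subgroup.center G) * Nat.card (Subgroup.center G) :=
    Subgroup.card_eq_card_quotient_mul_card_subgroup _
  have h0 : (Nat.card (Subgroup.center G) : ℚ) ≠ 0 := by exact_mod_cast Nat.card_pos.ne'
  have h1 : (Nat.card (G ⧸ Subgroup.center G) : ℚ) ≠ 0 := by exact_mod_cast Nat.card_pos.ne'
  rw [commProb_def, hc, hG]
  push_cast
  field_simp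

theorem IsIsoclinic.commProb_eq {G H : Type*} [Group G] [Group H] [Finite G] [Finite H]
    (h : IsIsoclinic G H) : commProb G = commProb H := by
  obtain ⟨φ, ψ, h⟩ := h
  rw [commProb_eq_card_quotient_center G, commProb_eq_card_quotient_center H,
    Nat.card_congr φ.toEquiv]
  congr 2
  refine Nat.card_congr ((φ.toEquiv.prodCongr φ.toEquiv).subtypeEquiv fun q => ?_)
  rw [← derivedCommutator_eq_one_iff, ← derivedCommutator_eq_one_iff,
    ← EmbeddingLike.map_eq_one_iff (f := ψ), h q.1.out q.2.out (φ q.1).out (φ q.2).out]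
  · rfl
  · rw [QuotientGroup.out_eq', QuotientGroup.out_eq']
  · rw [QuotientGroup.out_eq', QuotientGroup.out_eq']

/-- A surjection whose kernel meets the derived subgroup trivially is an isoclinism. -/
theorem isIsoclinic_of_surjective {G H : Type*} [Group G] [Group H] (f : G →* H)
    (hf : Function.Surjective f) (h : f.ker ⊓ commutator G = ⊥) : IsIsoclinic G H := by
  have hmap : (commutator G).map f = commutator H := by
    rw [commutator_def, commutator_def, Subgroup.map_commutator,
      ← MonoidHom.range_eq_map, MonoidHom.range_eq_top.2 hf]
  have hinj : ∀ x ∈ commutator G, f x = 1 → x = 1 := fun x hx hfx => by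
    have : x ∈ f.ker ⊓ commutator G := ⟨hfx, hx⟩
    rwa [h, Subgroup.mem_bot] at this
  have hker : ((QuotientGroup.mk' (Subgroup.center H)).comp f).ker = Subgroup.center G := by
    ext x
    rw [MonoidHom.mem_ker, MonoidHom.comp_apply, QuotientGroup.mk'_apply,
      QuotientGroup.eq_one_iff, Subgroup.mem_center_iff, Subgroup.mem_center_iff, hf.forall]
    refine forall_congr' fun y => ?_
    rw [← map_mul, ← map_mul, ← commutatorElement_eq_one_iff_mul_comm]
    constructor
    · intro hxy
      refine hinj _ (Subgroup.commutator_mem_commutator trivial trivial) ?_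
      rw [map_commutatorElement, commutatorElement_eq_one_iff_mul_comm, ← map_mul, ← map_mul, hxy]
    · intro hxy
      rw [commutatorElement_eq_one_iff_mul_comm] at hxy
      rw [hxy]
  let φ : G ⧸ Subgroup.center G ≃* H ⧸ Subgroup.center H :=
    (QuotientGroup.quotientMulEquivOfEq hker.symm).trans
      (QuotientGroup.quotientKerEquivOfSurjective _
        ((QuotientGroup.mk'_surjective (Subgroup.center H)).comp hf))
  let ψ₀ : commutator G →* commutator H :=
    (f.comp (commutator G).subtype).codRestrict (commutator H) fun x =>
      hmap ▸ Subgroup.mem_map_of_mem f x.2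
  have hψ₀ : Function.Bijective ψ₀ := by
    constructor
    · rw [injective_iff_map_eq_one]
      intro x hx
      exact Subtype.ext (hinj x x.2 (congrArg Subtype.val hx))
    · rintro ⟨y, hy⟩
      rw [← hmap] at hy
      obtain ⟨x, hx, rfl⟩ := hy
      exact ⟨⟨x, hx⟩, rfl⟩
  refine ⟨φ, MulEquiv.ofBijective ψ₀ hψ₀, fun g₁ g₂ h₁ h₂ e₁ e₂ => ?_⟩
  have hφ : ∀ g : G, φ (g : G ⧸ Subgroup.center G) = (f g : H ⧸ Subgroup.center H) :=
    fun _ => rfl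
  rw [hφ] at e₁ e₂
  obtain ⟨z₁, hz₁, rfl⟩ : ∃ z ∈ Subgroup.center H, f g₁ * z = h₁ :=
    ⟨_, QuotientGroup.eq.1 e₁, by simp⟩
  obtain ⟨z₂, hz₂, rfl⟩ : ∃ z ∈ Subgroup.center H, f g₂ * z = h₂ :=
    ⟨_, QuotientGroup.eq.1 e₂, by simp⟩
  refine Subtype.ext ?_
  change f ⁅g₁, g₂⁆ = ⁅f g₁ * z₁, f g₂ * z₂⁆
  rw [commutatorElement_mul_center hz₁ hz₂, map_commutatorElement]

theorem IsIsoclinic.not_isSupersolvable {G : Type*} [Group G]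
    (h : IsIsoclinic G (alternatingGroup (Fin 4))) : ¬ IsSupersolvable G := by
  obtain ⟨φ, -, -⟩ := h
  intro hG
  refine not_isSupersolvable_alternatingGroup_four ?_
  let e := φ.trans ((QuotientGroup.quotientMulEquivOfEq center_alternatingGroup_four).trans
    QuotientGroup.quotientBot)
  exact hG.of_surjective (e.toMonoidHom.comp (QuotientGroup.mk' (Subgroup.center G)))
    (e.surjective.comp (QuotientGroup.mk'_surjective _))

/-- The transfer to an abelian subgroup of finite index kills the derived subgroup, and raises
central elements to the power given by the index. -/
theorem pow_index_eq_one_of_mem_center {G : Type*} [Group G] (A : Subgroup G) [A.FiniteIndex]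
    (hA : ∀ x ∈ A, ∀ y ∈ A, x * y = y * x) {z : G} (hz : z ∈ Subgroup.center G)
    (hz' : z ∈ commutator G) : z ^ A.index = 1 := by
  let : CommGroup A := { (inferInstance : Group A) with
    mul_comm := fun x y => Subtype.ext (hA x x.2 y y.2) }
  let τ : G →* A := MonoidHom.transfer (MonoidHom.id A)
  have h1 : τ z = 1 := by
    have : commutator G ≤ τ.ker := Abelianization.commutator_subset_ker τ
    exact this hz'
  have h2 := MonoidHom.transfer_eq_pow (MonoidHom.id A) z fun k g₀ _ => by
    have := Subgroup.mem_center_iff.1 (Subgroup.pow_mem _ hz k) g₀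
    rw [mul_assoc, ← this, inv_mul_cancel_left]
  exact congrArg Subtype.val (h2.symm.trans h1)

/-- The structural description of the groups isoclinic to `A₄` that the argument uses: there is an
abelian normal subgroup of index `3`, and the center has index `12`. -/
def HasAlternatingFourType (G : Type*) [Group G] : Prop :=
  ∃ W : Subgroup G, W.Normal ∧ (∀ x ∈ W, ∀ y ∈ W, x * y = y * x) ∧ W.index = 3 ∧
    (Subgroup.center G).index = 12

/-- If `W` is abelian of prime index and `a ∉ W`, then what `W` shares with the centralizer of `a`
is central. -/
theorem mem_center_of_mem_of_commute {G : Type*} [Group G] {W : Subgroup G}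
    (hW : ∀ x ∈ W, ∀ y ∈ W, x * y = y * x) (hp : W.index.Prime) {a w : G} (ha : a ∉ W)
    (hw : w ∈ W) (haw : a * w = w * a) : w ∈ Subgroup.center G := by
  have hle : W ≤ Subgroup.centralizer {w} := fun x hx =>
    Subgroup.mem_centralizer_singleton_iff.2 (hW x hx w hw)
  have hdvd := Subgroup.index_dvd_of_le hle
  rcases (Nat.dvd_prime hp).1 hdvd with h | h
  · rw [Subgroup.index_eq_one] at h
    rw [Subgroup.mem_center_iff]
    intro g
    have : g ∈ Subgroup.centralizer {w} := h ▸ Subgroup.mem_top g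
    exact Subgroup.mem_centralizer_singleton_iff.1 this
  · exfalso
    have h1 := Subgroup.relIndex_mul_index hle
    rw [h] at h1
    have h2 : W.relIndex (Subgroup.centralizer {w}) = 1 :=
      Nat.eq_of_mul_eq_mul_right hp.pos (by simpa using h1)
    exact ha (Subgroup.relIndex_eq_one.1 h2 (Subgroup.mem_centralizer_singleton_iff.2 haw))

/-- The isoclinism comes from the action on the four cosets of the centralizer of an element
outside the abelian subgroup of index `3`. -/
theorem HasAlternatingFourType.isIsoclinic {G : Type*} [Group G] [Finite G]
    (h : HasAlternatingFourType G) : IsIsoclinic G (alternatingGroup (Fin 4)) := by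
  obtain ⟨W, hWn, hW, h3, h12⟩ := h
  obtain ⟨a, ha⟩ : ∃ a, a ∉ W := by
    by_contra! hcon
    rw [(Subgroup.eq_top_iff' W).2 hcon, Subgroup.index_top] at h3
    omega
  have hcenter : ∀ w ∈ W, a * w = w * a → w ∈ Subgroup.center G := fun w hw =>
    mem_center_of_mem_of_commute hW (h3 ▸ Nat.prime_three) ha hw
  have hZW : Subgroup.center G ≤ W := by
    intro z hz
    by_contra hzW
    have hle : W ≤ Subgroup.center G := fun w hw =>
      mem_center_of_mem_of_commute hW (h3 ▸ Nat.prime_three) hzW hw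
        (Subgroup.mem_center_iff.1 hz w).symm
    have := Subgroup.index_dvd_of_le hle
    rw [h3, h12] at this
    omega
  set H : Subgroup G := Subgroup.centralizer {a} with hH
  have haH : a ∈ H := Subgroup.mem_centralizer_singleton_iff.2 rfl
  have hZH : Subgroup.center G ≤ H := Subgroup.center_le_centralizer _
  have hHW : H ⊓ W = Subgroup.center G := by
    refine le_antisymm (fun x hx => ?_) (le_inf hZH hZW)
    exact hcenter x hx.2 (Subgroup.mem_centralizer_singleton_iff.1 hx.1).symm
  have hZH3 : (Subgroup.center G).relIndex H = 3 := by
    rw [← hHW, Subgroup.inf_relIndex_left]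
    have hdvd := Subgroup.relIndex_dvd_index_of_normal W H
    rw [h3] at hdvd
    exact ((Nat.dvd_prime Nat.prime_three).1 hdvd).resolve_left fun h1 =>
      ha (Subgroup.relIndex_eq_one.1 h1 haH)
  have hH4 : H.index = 4 := by
    have := Subgroup.relIndex_mul_index hZH
    rw [hZH3, h12] at this
    omega
  have : Fact (Nat.Prime 3) := ⟨Nat.prime_three⟩
  have hHab : ∀ x ∈ H, ∀ y ∈ H, x * y = y * x := by
    have : IsCyclic (H ⧸ (Subgroup.center G).subgroupOf H) := isCyclic_of_prime_card hZH3
    have := MonoidHom.isMulCommutative_of_isCyclic_of_ker_le_center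
      (QuotientGroup.mk' ((Subgroup.center G).subgroupOf H)) (by
        rw [QuotientGroup.ker_mk']
        intro x hx
        rw [Subgroup.mem_center_iff]
        exact fun y => Subtype.ext (Subgroup.mem_center_iff.1 hx y))
    exact fun x hx y hy => congrArg Subtype.val (mul_comm' (⟨x, hx⟩ : H) ⟨y, hy⟩)
  have hG'W : commutator G ≤ W := by
    have : IsCyclic (G ⧸ W) := isCyclic_of_prime_card h3
    rw [← Subgroup.Normal.quotient_commutative_iff_commutator_le]
    infer_instance
  have hG'Z : commutator G ⊓ Subgroup.center G = ⊥ := by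
    rw [eq_bot_iff]
    intro z hz
    have h1 := pow_index_eq_one_of_mem_center W hW hz.2 hz.1
    have h2 := pow_index_eq_one_of_mem_center H hHab hz.2 hz.1
    rw [h3] at h1
    rw [hH4, pow_succ, h1, one_mul] at h2
    exact h2
  let e : G ⧸ H ≃ Fin 4 := Finite.equivFinOfCardEq hH4
  let f : G →* Equiv.Perm (Fin 4) :=
    e.permCongrHom.toMonoidHom.comp (MulAction.toPermHom G (G ⧸ H))
  have hker : f.ker = H.normalCore := by
    rw [Subgroup.normalCore_eq_ker]
    exact MonoidHom.ker_mulEquiv_comp _ e.permCongrHom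
  have hkerG' : f.ker ⊓ commutator G = ⊥ := by
    rw [eq_bot_iff, hker, ← hG'Z]
    refine le_inf inf_le_right fun x hx => ?_
    rw [← hHW]
    exact ⟨H.normalCore_le hx.1, hG'W hx.2⟩
  have hkerZ : f.ker = Subgroup.center G := by
    refine le_antisymm (fun x hx => ?_) ?_
    · rw [Subgroup.mem_center_iff]
      intro g
      have : ⁅g, x⁆ ∈ f.ker ⊓ commutator G := Subgroup.mem_inf.2 ⟨
        by rw [MonoidHom.mem_ker, map_commutatorElement, MonoidHom.mem_ker.1 hx]; simp,
        Subgroup.commutator_mem_commutator trivial trivial⟩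
      rw [hkerG', Subgroup.mem_bot] at this
      exact commutatorElement_eq_one_iff_mul_comm.1 this
    · rw [hker, Subgroup.normal_le_normalCore]
      exact hZH
  have hrange : f.range = alternatingGroup (Fin 4) := by
    refine Equiv.Perm.eq_alternatingGroup_of_index_eq_two ?_
    have h1 : Nat.card f.range = 12 := by rw [← Subgroup.index_ker, hkerZ, h12]
    have h2 := Subgroup.card_mul_index f.range
    rw [h1, Nat.card_eq_fintype_card, Fintype.card_perm, Fintype.card_fin,
      show Nat.factorial 4 = 24 from rfl] at h2
    omega
  let f' : G →* alternatingGroup (Fin 4) :=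
    (MulEquiv.subgroupCongr hrange).toMonoidHom.comp f.rangeRestrict
  refine isIsoclinic_of_surjective f'
    ((MulEquiv.subgroupCongr hrange).surjective.comp f.rangeRestrict_surjective) ?_
  have hker' : f'.ker = f.ker :=
    (MonoidHom.ker_mulEquiv_comp _ (MulEquiv.subgroupCongr hrange)).trans f.ker_rangeRestrict
  rw [hker', hkerG']

/-! ### Commuting probability of a quotient -/

theorem commProb_le_commProb_quotient {G : Type*} [Group G] [Finite G] (N : Subgroup G)
    [N.Normal] : commProb G ≤ commProb (G ⧸ N) := by
  have h := commProb_le_of_card_inf_centralizer_le N 1 zero_le_one fun x _ => by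
    rw [one_mul]
    exact_mod_cast Subgroup.card_le_of_le inf_le_left
  have h1 : commProb N / (N.index : ℚ) ^ 2 ≤ 1 / (N.index : ℚ) ^ 2 :=
    div_le_div_of_nonneg_right (commProb_le_one N) (by positivity)
  linarith

/-- If `d(G) = d(G / N)`, then the pairs commuting in `G` are all the pairs commuting modulo `N`,
since the two sets have the same size. -/
theorem commute_of_commute_quotient {G : Type*} [Group G] [Finite G] (N : Subgroup G) [N.Normal]
    (h : commProb (G ⧸ N) ≤ commProb G) {x y : G} (hxy : Commute (x : G ⧸ N) (y : G ⧸ N)) :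
    Commute x y := by
  have hG : Nat.card G = Nat.card (G ⧸ N) * Nat.card N :=
    Subgroup.card_eq_card_quotient_mul_card_subgroup _
  have h0 : (0 : ℚ) < Nat.card N := by exact_mod_cast Nat.card_pos
  have h1 : (0 : ℚ) < Nat.card (G ⧸ N) := by exact_mod_cast Nat.card_pos
  have hcard : Nat.card { p : G × G // Commute (p.1 : G ⧸ N) (p.2 : G ⧸ N) } ≤
      Nat.card { p : G × G // Commute p.1 p.2 } := by
    rw [card_pairs_eq_card_quotient_pairs N fun q => Commute q.1 q.2]
    rw [commProb_def, commProb_def, hG, Nat.cast_mul,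
      div_le_div_iff₀ (by positivity) (by positivity)] at h
    have h2 : (Nat.card { q : (G ⧸ N) × (G ⧸ N) // Commute q.1 q.2 } : ℚ) *
        (Nat.card N * Nat.card N) ≤ Nat.card { p : G × G // Commute p.1 p.2 } :=
      le_of_mul_le_mul_right (by linarith) (pow_pos h1 2)
    exact_mod_cast h2
  have hsub : {p : G × G | Commute p.1 p.2} ⊆
      {p : G × G | Commute (p.1 : G ⧸ N) (p.2 : G ⧸ N)} :=
    fun p (hp : Commute p.1 p.2) => hp.map (QuotientGroup.mk' N)
  have heq := Set.eq_of_subset_of_ncard_le hsub hcard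
  exact (heq.symm ▸ hxy : (x, y) ∈ {p : G × G | Commute p.1 p.2})

/-- The hypothesis on `d(G)` makes `d(G) = d(G / N)`, so that commuting relations lift from
`G / N`. -/
theorem HasAlternatingFourType.of_quotient {G : Type*} [Group G] [Finite G] (N : Subgroup G)
    [N.Normal] (h : HasAlternatingFourType (G ⧸ N)) (hd : 1 / 3 ≤ commProb G) :
    HasAlternatingFourType G := by
  have hle : commProb (G ⧸ N) ≤ commProb G := by
    rw [h.isIsoclinic.commProb_eq, commProb_alternatingGroup_four]
    exact hd
  obtain ⟨W, hWn, hW, h3, h12⟩ := h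
  have hsurj := QuotientGroup.mk'_surjective N
  refine ⟨W.comap (QuotientGroup.mk' N), hWn.comap _, fun x hx y hy =>
    commute_of_commute_quotient N hle (hW _ hx _ hy), ?_, ?_⟩
  · rw [Subgroup.index_comap_of_surjective _ hsurj, h3]
  · rw [← h12, ← Subgroup.index_comap_of_surjective _ hsurj]
    congr 1
    ext z
    rw [Subgroup.mem_comap, Subgroup.mem_center_iff, Subgroup.mem_center_iff, hsurj.forall]
    refine forall_congr' fun g => ⟨fun h => ?_, fun h => commute_of_commute_quotient N hle h⟩
    rw [← map_mul, ← map_mul, h]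

/-! ### Minimal normal subgroups -/

/-- `N` is a minimal normal subgroup of `G`: it is normal and nontrivial, and every nontrivial
normal subgroup of `G` contained in `N` equals `N`. -/
structure IsMinimalNormal {G : Type*} [Group G] (N : Subgroup G) : Prop where
  normal : N.Normal
  ne_bot : N ≠ ⊥
  eq_of_le : ∀ K : Subgroup G, K.Normal → K ≤ N → K ≠ ⊥ → K = N

theorem exists_isMinimalNormal (G : Type*) [Group G] [Finite G] [Nontrivial G] :
    ∃ N : Subgroup G, IsMinimalNormal N := by
  obtain ⟨N, hN⟩ := (Set.toFinite {N : Subgroup G | N.Normal ∧ N ≠ ⊥}).exists_minimal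
    ⟨⊤, inferInstance, top_ne_bot⟩
  exact ⟨N, hN.prop.1, hN.prop.2, fun K hK hle hne =>
    le_antisymm hle (hN.le_of_le ⟨hK, hne⟩ hle)⟩

theorem Subgroup.card_mul_card_le_of_disjoint {G : Type*} [Group G] [Finite G]
    {A B C : Subgroup G} (hA : A ≤ C) (hB : B ≤ C) (h : Disjoint A B) :
    Nat.card A * Nat.card B ≤ Nat.card C := by
  rw [← Nat.card_prod]
  refine Nat.card_le_card_of_injective
    (fun p : A × B => (⟨p.1 * p.2, C.mul_mem (hA p.1.2) (hB p.2.2)⟩ : C)) fun p q hpq => ?_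
  exact Subgroup.mul_injective_of_disjoint h (congrArg Subtype.val hpq)

/-! ### Nonabelian minimal normal subgroups -/

theorem isSolvable_perm_fin_four : Group.IsSolvable (Equiv.Perm (Fin 4)) := by
  have h4 : Nat.card (Fin 4) = 4 := by simp
  have hA : Group.IsSolvable (alternatingGroup (Fin 4)) := by
    have := alternatingGroup.normal_kleinFour h4
    rw [Group.isSolvable_iff_subgroup_quotient (alternatingGroup.kleinFour (Fin 4))]
    constructor
    · have := (alternatingGroup.kleinFour_isKleinFour h4).isMulCommutative
      exact Group.isSolvable_of_comm mul_comm'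
    · have := Subgroup.Normal.quotient_commutative_iff_commutator_le.2
        (alternatingGroup.kleinFour_eq_commutator h4).ge
      exact Group.isSolvable_of_comm mul_comm'
  rw [Group.isSolvable_iff_subgroup_quotient (alternatingGroup (Fin 4))]
  refine ⟨hA, ?_⟩
  have : Fact (Nat.Prime 2) := ⟨Nat.prime_two⟩
  have : IsCyclic (Equiv.Perm (Fin 4) ⧸ alternatingGroup (Fin 4)) :=
    isCyclic_of_prime_card alternatingGroup.index_eq_two
  exact Group.isSolvable_of_comm mul_comm'

/-- A perfect group acts trivially on at most four cosets, because the symmetric group of degree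
four is solvable. -/
theorem eq_top_of_index_le_four {K : Type*} [Group K] [Finite K] (hK : commutator K = ⊤)
    (H : Subgroup K) (hH : H.index ≤ 4) : H = ⊤ := by
  let e : K ⧸ H ↪ Fin 4 := (Finite.equivFin (K ⧸ H)).toEmbedding.trans (Fin.castLEEmb hH)
  let f : K →* Equiv.Perm (Fin 4) :=
    (Equiv.Perm.viaEmbeddingHom e).comp (MulAction.toPermHom K (K ⧸ H))
  have hder : ∀ n, derivedSeries K n = ⊤ := by
    intro n
    induction n with
    | zero => rfl
    | succ n ih => rw [derivedSeries_succ, ih, ← commutator_def, hK]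
  obtain ⟨n, hn⟩ := isSolvable_perm_fin_four
  have hle := map_derivedSeries_le_derivedSeries f n
  rw [hn, hder] at hle
  have hf : ∀ x, MulAction.toPermHom K (K ⧸ H) x = 1 := fun x =>
    (injective_iff_map_eq_one _).1 (Equiv.Perm.viaEmbeddingHom_injective e) _
      (hle (Subgroup.mem_map_of_mem f (Subgroup.mem_top x)))
  rw [eq_top_iff]
  intro x _
  refine H.normalCore_le ?_
  rw [Subgroup.normalCore_eq_ker]
  exact hf x

/-- A nonabelian minimal normal subgroup `N` is perfect and meets its centralizer trivially, so
every element outside `C_G(N)` has at least five conjugates, and `C_G(N)` has index at least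
`|N| ≥ 10`. -/
theorem commProb_lt_of_isMinimalNormal_of_not_commute {G : Type*} [Group G] [Finite G]
    {N : Subgroup G} (hN : IsMinimalNormal N) (h : ¬ ∀ x ∈ N, ∀ y ∈ N, x * y = y * x) :
    commProb G < 1 / 3 := by
  have := hN.normal
  have hperf : commutator N = ⊤ := by
    have h1 : ⁅N, N⁆ = N := by
      refine hN.eq_of_le _ inferInstance N.commutator_le_self fun hbot => h ?_
      rw [Subgroup.commutator_eq_bot_iff_le_centralizer] at hbot
      exact fun x hx y hy => (Subgroup.mem_centralizer_iff.1 (hbot hx) y hy).symm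
    rw [← Subgroup.map_subtype_commutator] at h1
    refine Subgroup.map_injective N.subtype_injective ?_
    rw [h1, ← MonoidHom.range_eq_map, Subgroup.range_subtype]
  set D := Subgroup.centralizer (N : Set G) with hD
  have hdisj : Disjoint N D := by
    rw [disjoint_iff]
    by_contra hne
    have h1 := hN.eq_of_le _ inferInstance inf_le_left hne
    exact h fun x hx y hy => (Subgroup.mem_centralizer_iff.1 (h1.symm ▸ hx : x ∈ N ⊓ D).2 y hy).symm
  have hrel : ∀ x ∉ D, 5 ≤ (Subgroup.centralizer {x}).relIndex N := by
    intro x hx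
    by_contra! hlt
    have h1 := eq_top_of_index_le_four hperf ((Subgroup.centralizer {x}).subgroupOf N)
      (Nat.lt_succ_iff.1 hlt)
    rw [Subgroup.subgroupOf_eq_top] at h1
    refine hx (Subgroup.mem_centralizer_iff.2 fun n hn => ?_)
    exact Subgroup.mem_centralizer_singleton_iff.1 (h1 hn)
  have hN10 : 10 ≤ Nat.card N := by
    obtain ⟨x, hx1⟩ := N.ne_bot_iff_exists_ne_one.1 hN.ne_bot
    have hxD : (x : G) ∉ D := fun h => hx1 (Subtype.ext (Subgroup.disjoint_def.1 hdisj x.2 h))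
    have h1 := hrel x hxD
    have h2 := ((Subgroup.centralizer {(x : G)}).subgroupOf N).card_mul_index
    have h3 : 1 < Nat.card ((Subgroup.centralizer {(x : G)}).subgroupOf N) := by
      rw [Subgroup.one_lt_card_iff_ne_bot, Subgroup.ne_bot_iff_exists_ne_one]
      exact ⟨⟨x, Subgroup.mem_subgroupOf.2 (Subgroup.mem_centralizer_singleton_iff.2 rfl)⟩,
        fun h => hx1 (congrArg Subtype.val h)⟩
    rw [Subgroup.relIndex] at h1
    nlinarith
  have hN10' : 10 ≤ D.index := by
    have h1 := Subgroup.card_mul_card_le_of_disjoint le_top le_top hdisj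
    rw [Subgroup.card_top, ← D.card_mul_index, mul_comm] at h1
    exact hN10.trans (Nat.le_of_mul_le_mul_left h1 Nat.card_pos)
  have hbound := commProb_le_of_card_centralizer_le D (1 / 5) fun x hx => by
    have h1 : 5 ≤ (Subgroup.centralizer {x}).index :=
      (hrel x hx).trans (by
        rw [← Subgroup.relIndex_top_right]
        exact Subgroup.relIndex_le_of_le_right le_top
          (by rw [Subgroup.relIndex_top_right]; exact Subgroup.index_ne_zero_of_finite))
    have h2 : Nat.card (Subgroup.centralizer {x}) * 5 ≤ Nat.card G := by
      rw [← (Subgroup.centralizer {x}).card_mul_index]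
      exact Nat.mul_le_mul_left _ h1
    have h3 : (Nat.card (Subgroup.centralizer {x}) * 5 : ℚ) ≤ Nat.card G := by exact_mod_cast h2
    linarith
  have h10 : (10 : ℚ) ≤ D.index := by exact_mod_cast hN10'
  have : (1 - 1 / 5 : ℚ) / D.index ≤ (1 - 1 / 5) / 10 := by gcongr
  linarith

/-! ### Abelian noncyclic minimal normal subgroups -/

/-- The centralizer `C` of `N` is the abelian subgroup of index `3`. The bound
`commProb_le_of_card_inf_centralizer_le` is applied with `ε = 1 / 2` to exclude a nonabelian
`G ⧸ C`, with `ε = 1 / 4` to find that `C` is abelian of index `3`, and with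
`ε = |Z(G)| / |C|` to find `|C : Z(G)| = 4`. -/
theorem hasAlternatingFourType_of_isMinimalNormal {G : Type*} [Group G] [Finite G]
    {N : Subgroup G} (hN : IsMinimalNormal N) (hab : ∀ x ∈ N, ∀ y ∈ N, x * y = y * x)
    (hcyc : ¬ IsCyclic N) (hd : 1 / 3 ≤ commProb G) : HasAlternatingFourType G := by
  have := hN.normal
  set C := Subgroup.centralizer (N : Set G) with hC
  have hNC : N ≤ C := fun x hx => Subgroup.mem_centralizer_iff.2 fun y hy => hab y hy x hx
  have hi0 : (0 : ℚ) < C.index := by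
    exact_mod_cast Nat.pos_of_ne_zero Subgroup.index_ne_zero_of_finite
  have hC0 : (0 : ℚ) < Nat.card C := by exact_mod_cast Nat.card_pos
  have hne : ∀ x ∉ C, ∃ n ∈ N, n * x ≠ x * n := fun x hx => by
    by_contra! hcon
    exact hx (Subgroup.mem_centralizer_iff.2 hcon)
  by_cases hM : ∃ a b : G ⧸ C, a * b ≠ b * a
  · exfalso
    obtain ⟨a, b, hM⟩ := hM
    have hbound := commProb_le_of_card_inf_centralizer_le C (1 / 2) (by norm_num) fun x hx => by
      have h1 : (Subgroup.centralizer {x}).subgroupOf C ≠ ⊤ := fun htop => by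
        obtain ⟨n, hn, hnx⟩ := hne x hx
        rw [Subgroup.subgroupOf_eq_top] at htop
        exact hnx (Subgroup.mem_centralizer_singleton_iff.1 (htop (hNC hn)))
      have h2 := Subgroup.two_mul_card_le_of_ne_top h1
      have h3 : Nat.card ((Subgroup.centralizer {x}).subgroupOf C) =
          Nat.card (C ⊓ Subgroup.centralizer {x} : Subgroup G) := by
        rw [← Subgroup.inf_subgroupOf_left]
        exact Nat.card_congr (Subgroup.subgroupOfEquivOfLe inf_le_left).toEquiv
      rw [h3] at h2
      have h4 : (2 * Nat.card (C ⊓ Subgroup.centralizer {x} : Subgroup G) : ℚ) ≤ Nat.card C := by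
        exact_mod_cast h2
      linarith
    -- The bound is `5 / 16 + 1 / 50 < 1 / 3`.
    have h58 := commProb_le_five_eighths hM
    have h5 : (5 : ℚ) ≤ C.index := by exact_mod_cast five_le_card_of_not_commute hM
    have h1 : commProb C / (C.index : ℚ) ^ 2 ≤ 1 / (C.index : ℚ) ^ 2 := by
      gcongr
      exact commProb_le_one C
    have h2 : 1 / (C.index : ℚ) ^ 2 ≤ 1 / 5 ^ 2 := by gcongr
    linarith
  push Not at hM
  -- The set of fixed points in `N` of an element is normal in `G`, since `G ⧸ C` is abelian.
  have hfix : ∀ x ∉ C, Disjoint N (Subgroup.centralizer {x}) := by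
    intro x hx
    rw [disjoint_iff]
    by_contra hbot
    have hnorm : (N ⊓ Subgroup.centralizer {x}).Normal := by
      refine ⟨fun n hn g => ⟨hN.normal.conj_mem n hn.1 g, ?_⟩⟩
      have hnx := Subgroup.mem_centralizer_singleton_iff.1 hn.2
      obtain ⟨c, hc, hxg⟩ : ∃ c ∈ C, x * g = g * x * c := by
        refine ⟨(g * x)⁻¹ * (x * g), ?_, by group⟩
        rw [← QuotientGroup.eq, QuotientGroup.mk_mul, QuotientGroup.mk_mul]
        exact hM _ _
      have hcn := Subgroup.mem_centralizer_iff.1 hc n hn.1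
      refine Subgroup.mem_centralizer_singleton_iff.2 (Eq.symm ?_)
      calc x * (g * n * g⁻¹) = x * g * n * g⁻¹ := by group
        _ = g * x * (c * n) * g⁻¹ := by rw [hxg]; group
        _ = g * (x * n) * c * g⁻¹ := by rw [← hcn]; group
        _ = g * n * g⁻¹ * (g * x * c) * g⁻¹ := by rw [← hnx]; group
        _ = g * n * g⁻¹ * x := by rw [← hxg]; group
    have heq := hN.eq_of_le _ hnorm inf_le_left hbot
    obtain ⟨n, hn, hnx⟩ := hne x hx
    rw [← heq] at hn
    exact hnx (Subgroup.mem_centralizer_singleton_iff.1 hn.2)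
  have hq : 4 ≤ Nat.card N := by
    by_contra! hlt
    have h1 : Nat.card N ≠ 0 := Nat.card_pos.ne'
    have h2 : Nat.card N = 1 ∨ Nat.card N = 2 ∨ Nat.card N = 3 := by omega
    refine hcyc ?_
    rcases h2 with h2 | h2 | h2
    · have := (Nat.card_eq_one_iff_unique.1 h2).1
      infer_instance
    · have : Fact (Nat.Prime 2) := ⟨Nat.prime_two⟩
      exact isCyclic_of_prime_card h2
    · have : Fact (Nat.Prime 3) := ⟨Nat.prime_three⟩
      exact isCyclic_of_prime_card h2
  -- If `C` had index at most `2`, every conjugation would fix or invert the elements of `N`, and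
  -- every cyclic subgroup of `N` would be normal in `G`.
  have hm : 3 ≤ C.index := by
    by_contra! hlt
    have hconj : ∀ g, ∀ n ∈ N, g * n * g⁻¹ = n ∨ g * n * g⁻¹ = n⁻¹ := by
      intro g n hn
      by_cases hg : g ∈ C
      · left
        rw [← Subgroup.mem_centralizer_iff.1 hg n hn]
        simp
      · right
        have hi : C.index = 2 := by
          have h1 : C.index ≠ 0 := Subgroup.index_ne_zero_of_finite
          have h2 : C.index ≠ 1 := fun h1 => hg (by
            rw [Subgroup.index_eq_one.1 h1]; trivial)
          omega
        have hg2 : g * g ∈ C := Subgroup.mul_self_mem_of_index_two hi g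
        -- `n` times its conjugate is fixed by `g`.
        have hmem : n * (g * n * g⁻¹) ∈ N ⊓ Subgroup.centralizer {g} := by
          have hng := hN.normal.conj_mem n hn g
          refine ⟨N.mul_mem hn hng, Subgroup.mem_centralizer_singleton_iff.2 (Eq.symm ?_)⟩
          have hcn := Subgroup.mem_centralizer_iff.1 hg2 n hn
          calc g * (n * (g * n * g⁻¹)) = g * g * n * g⁻¹ * n := by rw [hab n hn _ hng]; group
            _ = n * (g * n * g⁻¹) * g := by rw [← hcn]; group
        rw [disjoint_iff.1 (hfix g hg), Subgroup.mem_bot] at hmem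
        exact eq_inv_of_mul_eq_one_right hmem
    obtain ⟨⟨n, hn⟩, hn1⟩ := N.ne_bot_iff_exists_ne_one.1 hN.ne_bot
    have hnorm : (Subgroup.zpowers n).Normal := by
      refine ⟨fun y hy g => ?_⟩
      obtain ⟨k, rfl⟩ := hy
      change g * n ^ k * g⁻¹ ∈ _
      rw [← conj_zpow]
      refine Subgroup.zpow_mem _ ?_ k
      rcases hconj g n hn with h | h <;> rw [h]
      · exact Subgroup.mem_zpowers n
      · exact Subgroup.inv_mem _ (Subgroup.mem_zpowers n)
    have heq := hN.eq_of_le _ hnorm (by simpa using hn) (by simpa using hn1)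
    exact hcyc (heq ▸ inferInstance)
  have hMone : commProb (G ⧸ C) = 1 := commProb_eq_one_iff.2 ⟨⟨hM⟩⟩
  have hbound := commProb_le_of_card_inf_centralizer_le C (1 / 4) (by norm_num) fun x hx => by
    have h1 := Subgroup.card_mul_card_le_of_disjoint hNC
      (inf_le_left : C ⊓ Subgroup.centralizer {x} ≤ C) ((hfix x hx).mono_right inf_le_right)
    have h2 : 4 * Nat.card (C ⊓ Subgroup.centralizer {x} : Subgroup G) ≤ Nat.card C :=
      (Nat.mul_le_mul_right _ hq).trans h1
    have h3 : (4 * Nat.card (C ⊓ Subgroup.centralizer {x} : Subgroup G) : ℚ) ≤ Nat.card C := by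
      exact_mod_cast h2
    linarith
  have hC1 : commProb C ≤ 1 := commProb_le_one C
  rw [hMone] at hbound
  have h3 : C.index = 3 := by
    refine le_antisymm ?_ hm
    by_contra! hlt
    have h4 : (4 : ℚ) ≤ C.index := by exact_mod_cast hlt
    have h1 : commProb C / (C.index : ℚ) ^ 2 ≤ 1 / (C.index : ℚ) ^ 2 := by gcongr
    have h2 : 1 / (C.index : ℚ) ^ 2 ≤ 1 / 4 ^ 2 := by gcongr
    linarith
  rw [h3] at hbound
  have hCab : ∀ x ∈ C, ∀ y ∈ C, x * y = y * x := by
    have h1 : commProb C = 1 := le_antisymm hC1 (by norm_num at hbound; linarith)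
    have := commProb_eq_one_iff.1 h1
    exact fun x hx y hy => congrArg Subtype.val (mul_comm' (⟨x, hx⟩ : C) ⟨y, hy⟩)
  have hcen : ∀ x ∉ C, C ⊓ Subgroup.centralizer {x} ≤ Subgroup.center G := fun x hx w hw =>
    mem_center_of_mem_of_commute hCab (h3 ▸ Nat.prime_three) hx hw.1
      (Subgroup.mem_centralizer_singleton_iff.1 hw.2).symm
  have hZC : Subgroup.center G ≤ C := Subgroup.center_le_centralizer _
  obtain ⟨a, ha⟩ : ∃ a, a ∉ C := by
    by_contra! hcon
    rw [(Subgroup.eq_top_iff' C).2 hcon, Subgroup.index_top] at h3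
    omega
  have hle : 4 * Nat.card (Subgroup.center G) ≤ Nat.card C :=
    (Nat.mul_le_mul_right _ hq).trans (Subgroup.card_mul_card_le_of_disjoint hNC hZC
      ((hfix a ha).mono_right (Subgroup.center_le_centralizer _)))
  have hge : Nat.card C ≤ 4 * Nat.card (Subgroup.center G) := by
    have h1 := commProb_le_of_card_inf_centralizer_le C
      (Nat.card (Subgroup.center G) / Nat.card C) (by positivity) fun x hx => by
        rw [div_mul_cancel₀ _ hC0.ne']
        exact_mod_cast Subgroup.card_le_of_le (hcen x hx)
    rw [hMone, h3] at h1
    have h2 : (1 / 4 : ℚ) ≤ Nat.card (Subgroup.center G) / Nat.card C := by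
      norm_num at h1
      linarith
    rw [div_le_div_iff₀ (by norm_num) hC0] at h2
    have h4 : (Nat.card C : ℚ) ≤ 4 * Nat.card (Subgroup.center G) := by linarith
    exact_mod_cast h4
  refine ⟨C, inferInstance, hCab, h3, ?_⟩
  have h1 := (Subgroup.center G).card_mul_index
  rw [← C.card_mul_index, h3, le_antisymm hge hle] at h1
  have h2 : 0 < Nat.card (Subgroup.center G) := Nat.card_pos
  refine Nat.eq_of_mul_eq_mul_left h2 ?_
  linarith

/-! ### The classification -/

theorem hasAlternatingFourType_of_not_isSupersolvable {G : Type*} [Group G] [Finite G]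
    (hd : 1 / 3 ≤ commProb G) (hG : ¬ IsSupersolvable G) : HasAlternatingFourType G := by
  induction hn : Nat.card G using Nat.strong_induction_on generalizing G with
  | _ n ih =>
    have : Nontrivial G := by
      by_contra h
      rw [not_nontrivial_iff_subsingleton] at h
      exact hG isSupersolvable_of_subsingleton
    obtain ⟨N, hN⟩ := exists_isMinimalNormal G
    have := hN.normal
    by_cases hab : ∀ x ∈ N, ∀ y ∈ N, x * y = y * x
    · by_cases hcyc : IsCyclic N
      · refine HasAlternatingFourType.of_quotient N (ih _ ?_
          (hd.trans (commProb_le_commProb_quotient N))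
          (fun h => hG (h.of_quotient N hcyc)) rfl) hd
        have h1 := Subgroup.card_eq_card_quotient_mul_card_subgroup N
        have h2 := N.one_lt_card_iff_ne_bot.2 hN.ne_bot
        have h3 : 0 < Nat.card (G ⧸ N) := Nat.card_pos
        rw [← hn, h1]
        nlinarith
      · exact hasAlternatingFourType_of_isMinimalNormal hN hab hcyc hd
    · exact absurd hd (not_le.2 (commProb_lt_of_isMinimalNormal_of_not_commute hN hab))

theorem corollary1p2 {G : Type*} [Group G] [Finite G] :
    (1 / 3 ≤ commProb G → IsSupersolvable G ∨ IsIsoclinic G (alternatingGroup (Fin 4))) ∧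
    ((1 / 3 ≤ commProb G ∧ ¬ IsSupersolvable G) ↔
      IsIsoclinic G (alternatingGroup (Fin 4))) := by
  have key : 1 / 3 ≤ commProb G → ¬ IsSupersolvable G →
      IsIsoclinic G (alternatingGroup (Fin 4)) := fun hd hG =>
    (hasAlternatingFourType_of_not_isSupersolvable hd hG).isIsoclinic
  refine ⟨fun hd => or_iff_not_imp_left.2 (key hd), fun h => key h.1 h.2, fun h => ⟨?_, ?_⟩⟩
  · rw [h.commProb_eq, commProb_alternatingGroup_four]
  · exact h.not_isSupersolvable
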